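/- Theorem 1.2. Let $q$ be a power of an odd prime, $R=\mathbb{F}_q[T]$, $R_1\subset R$ the set of monic polynomials, $k_\infty=\mathbb{F}_q((1/T))$, and $k_\infty^{ac}$ an algebraic closure of $k_\infty$ with the absolute value extending that of $k_\infty$. Let $\tilde\pi\in k_\infty^{ac}$ be a Carlitz period, i.e. $\tilde\pi=(-T)^{1/(q-1)}\,T\prod_{i\ge1}(1-T^{1-q^i})^{-1}$ for some choice of the $(q-1)$-th root, and let $$e(z)=z\prod_{0\ne A\in R}\Bigl(1-\frac{z}{\tilde\pi A}\Bigr)$$ be the Carlitz exponential. Let $D_i=\prod_{0\le l<i}(T^{q^i}-T^{q^l})$ and $\Gamma_m=\prod_i D_i^{m_i}$ for $m=\sum_i m_iq^i$ in base $q$, and let the Bernoulli–Carlitz numbers $BC_m$ be defined by $\frac{z}{e(z)}=\sum_{m\ge0}\frac{BC_m}{\Gamma_m}z^m$ near $z=0$ (so $BC_0=\Gamma_0=1$). Let $\alpha,\beta\in k_\infty^{ac}$ with $\alpha\beta=\tilde\pi^2$, let $j$ be a positive integer, and put $$S_j(\gamma)=\sum_{A\in R_1}\frac{A^{-(q-1)j-(q-2)}}{e(\gamma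 A)}\qquad(\gamma\in\{\alpha,\beta\}).$$ (i) If $\alpha\notin\tilde\pi k_\infty$, then $e(\alpha A)\neq0$ and $e(\beta A)\ne0$ for all $A\in R_1$, and the series $S_j(\alpha)$ and $S_j(\beta)$ converge. (ii) Whenever $e(\alpha A)\neq0$ and $e(\beta A)\ne0$ for all $A\in R_1$ and the series $S_j(\alpha)$ and $S_j(\beta)$ converge (unconditionally), then $$\alpha^{-\frac{q-1}{2}(j-1)-(q-2)}S_j(\alpha)+\beta^{-\frac{q-1}{2}(j-1)-(q-2)}S_j(\beta)=\sum_{k=0}^{j+1}\frac{BC_{(q-1)(j-k+1)}}{\Gamma_{(q-1)(j-k+1)}}\,\frac{BC_{(q-1)k}}{\Gamma_{(q-1)k}}\,\alpha^{\frac{q-1}{2}k}\beta^{\frac{q-1}{2}(j-k+1)}.$$ -/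

import Mathlib

open scoped Polynomial Topology NNReal WithZero

noncomputable section

namespace Carlitz

variable (F : Type*) [Field F]

open Classical in
/-- The field `k_∞ = F((1/T))`: the completion of `k = F(T)` at the infinite place. -/
abbrev KInf : Type _ := RatFunc.CompletionAtInfty F

theorem valued_X : Valued.v (algebraMap (RatFunc F) (KInf F) RatFunc.X) =
    (WithZero.exp 1 : ℤᵐ⁰) := by
  classical
  rw [RatFunc.valuedCompletionAtInfty.def]
  let _ := RatFunc.inftyValued F
  refine (Valued.extensionValuation_apply_coe (K := RatFunc F) RatFunc.X).trans ?_
  exact RatFunc.inftyValuation.X F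

open Classical in
instance completeSpaceKInf : CompleteSpace (KInf F) :=
  inferInstanceAs (@CompleteSpace (@UniformSpace.Completion (RatFunc F)
    (RatFunc.inftyValued F).toUniformSpace) _)

variable [Fintype F]

/-- The order `q` of the finite field `F`. -/
abbrev q : ℕ := Fintype.card F

theorem one_lt_q : (1 : ℝ≥0) < (q F : ℝ≥0) := by
  exact_mod_cast Fintype.one_lt_card

/-- The valuation of `k_∞` has rank one; absolute values are normalized by `|T| = q`. -/
instance rankOneKInf : (Valued.v : Valuation (KInf F) ℤᵐ⁰).RankOne where
  hom' := (WithZeroMulInt.toNNReal (one_lt_q F).ne_zero).comp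
    (MonoidWithZeroHom.ValueGroup₀.embedding (f := .ofClass (Valued.v : Valuation (KInf F) ℤᵐ⁰)))
  strictMono' := (WithZeroMulInt.toNNReal_strictMono (one_lt_q F)).comp
    MonoidWithZeroHom.ValueGroup₀.embedding_strictMono
  exists_val_nontrivial := by
    refine ⟨algebraMap (RatFunc F) (KInf F) RatFunc.X, ?_⟩
    rw [valued_X]
    exact ⟨WithZero.exp_ne_zero, fun h => by simp [WithZero.exp_eq_one] at h⟩

/-- The absolute value of `k_∞`; its topology is the one of the completion. -/
instance nontriviallyNormedFieldKInf : NontriviallyNormedField (KInf F) :=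
  Valued.toNontriviallyNormedField (KInf F) ℤᵐ⁰

/-- A fixed algebraic closure `k_∞^ac` of `k_∞`. -/
abbrev KInfAC : Type _ := AlgebraicClosure (KInf F)

/-- The absolute value of `k_∞^ac`: the unique extension of the absolute value of `k_∞`. -/
instance nontriviallyNormedFieldKInfAC : NontriviallyNormedField (KInfAC F) :=
  spectralNorm.nontriviallyNormedField (KInf F) (KInfAC F)

/-- The inclusion of `R = F[T]` in `k_∞^ac`. -/
def ofPoly : F[X] →+* KInfAC F :=
  (algebraMap (KInf F) (KInfAC F)).comp
    ((algebraMap (RatFunc F) (KInf F)).comp (algebraMap F[X] (RatFunc F)))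

/-- The set `R₁` of monic polynomials, as a type. -/
abbrev Monic₁ : Type _ := {A : F[X] // A.Monic}

variable {F}

/-- `ϖ` is a period of the Carlitz module (it is determined up to a factor in `Fˣ`):
`ϖ = (-T)^(1/(q-1)) * T * ∏_{i ≥ 1} (1 - T^(1 - q^i))⁻¹` for some choice of the root. -/
def IsCarlitzPeriod (ϖ : KInfAC F) : Prop :=
  ϖ ^ (q F - 1) = -ofPoly F Polynomial.X *
    (ofPoly F Polynomial.X *
      ∏' i : ℕ, (1 - ofPoly F Polynomial.X ^ (1 - (q F : ℤ) ^ (i + 1)))⁻¹) ^ (q F - 1)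

/-- The Carlitz exponential, the exponential of the lattice `ϖ R`:
`e(z) = z * ∏_{0 ≠ A ∈ R} (1 - z / (ϖ A))`. -/
def carlitzExp (ϖ z : KInfAC F) : KInfAC F :=
  z * ∏' A : {A : F[X] // A ≠ 0}, (1 - z / (ϖ * ofPoly F A))

variable (F) in
/-- `D_i = ∏_{j < i} (T^(q^i) - T^(q^j))`, the product of the monic polynomials of degree `i`. -/
def carlitzD (i : ℕ) : F[X] :=
  ∏ j ∈ Finset.range i, (Polynomial.X ^ (q F ^ i) - Polynomial.X ^ (q F ^ j))

variable (F) in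
/-- The Carlitz factorial `Γ_m = ∏_i D_i ^ (m_i)`, where `m = ∑_i m_i q^i` is the base `q`
expansion (the digits `m_i` with `i > m` vanish). -/
def carlitzFactorial (m : ℕ) : F[X] :=
  ∏ i ∈ Finset.range (m + 1), carlitzD F i ^ (m / q F ^ i % q F)

/-- `z / e(z) = ∑_m c_m z^m` for all `z ≠ 0` in a neighbourhood of `0`. -/
def IsExpansion (ϖ : KInfAC F) (c : ℕ → KInfAC F) : Prop :=
  ∀ᶠ z in 𝓝[≠] (0 : KInfAC F), HasSum (fun m => c m * z ^ m) (z / carlitzExp ϖ z)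

/-- The Bernoulli-Carlitz numbers `BC_m`: the quantities `BC_m / Γ_m` are the coefficients of the
expansion of `z / e(z)` at `0`. -/
def bernoulliCarlitz (ϖ : KInfAC F) (m : ℕ) : KInfAC F :=
  ofPoly F (carlitzFactorial F m) * Classical.epsilon (IsExpansion ϖ) m

/-- The quotient `BC_m / Γ_m`. -/
def bcQuot (ϖ : KInfAC F) (m : ℕ) : KInfAC F :=
  bernoulliCarlitz ϖ m / ofPoly F (carlitzFactorial F m)

/-- The term of the series over monic `A`: `A^(-(q-1)j-(q-2)) / e(α A)`. -/
def ramanujanTerm (ϖ : KInfAC F) (j : ℕ) (α : KInfAC F) (A : Monic₁ F) : KInfAC F :=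
  ofPoly F A ^ (-((q F : ℤ) - 1) * j - ((q F : ℤ) - 2)) / carlitzExp ϖ (α * ofPoly F A)

end Carlitz

end

/-! Write `R = F[T]`. For a finite additive subgroup `V`, the polynomial `∏ (X - v)` has constant
derivative, so `∑ 1/(z - v)` is the inverse of `z ∏ (1 - z/v)`. Exhausting `ϖR` by such subgroups
gives `1/e(z) = ∑_B 1/(z - ϖB)` (`tsum_inv_sub_mul_latticeExp`). Geometric expansion then shows that
the coefficients `BC_m/Γ_m` of `z/e(z)` are `1` for `m = 0` and `-∑_{B ≠ 0} (ϖB)⁻ᵐ` otherwise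
(`hasSum_div_latticeExp`).

Put `N = (q-1)j + (q-2)` and sum `(αA)⁻ᴺ/(αA - ϖB)` over nonzero `A`, `B` in two ways
(`expTerm_reciprocity`). Summing over `B` first gives the series in `1/e(αA)`, up to a power sum.
Partial fractions trade `(αA)⁻ᴺ` for `(ϖB)⁻ᴺ` at the cost of products of power sums; since `αβ = ϖ²`
gives `αA - ϖB = -(α/ϖ)(βB - ϖA)`, summing over `A` first then gives the series in `1/e(βB)`. As
`q-1` divides `N+1 = (q-1)(j+1)`, the terms are invariant under `Fˣ`, so sums over nonzero
polynomials are `q-1 = -1` times sums over monic ones. The same scaling kills the power sums with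
`q-1 ∤ m`.

The field `k_∞^ac` need not be complete, but each series lives in a finite, hence complete,
extension of `k_∞`, where an ultrametric family tending to zero is summable. The double series is
controlled by `norm_inv_sub_le_max`; part (i) rests on `exists_le_norm_mul_sub`. -/

noncomputable section

open Filter

namespace Carlitz

/-! ### Ultrametric sums and products inside a complete subfield -/

section Ultrametric

variable {ι κ K : Type*} [NormedField K] [IsUltrametricDist K]

/-- A family in a complete subfield that tends to zero is summable. -/
theorem summable_of_mem_of_tendsto_zero {L : Subfield K} (hL : IsComplete (L : Set K))
    {f : ι → K} (hf : ∀ i, f i ∈ L) (h0 : Tendsto f cofinite (𝓝 0)) : Summable f := by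
  have : CompleteSpace L := completeSpace_coe_iff_isComplete.2 hL
  have : IsUltrametricDist L := ⟨fun x y z => dist_triangle_max (x : K) y z⟩
  have hs : Summable fun i => (⟨f i, hf i⟩ : L) := by
    apply NonarchimedeanAddGroup.summable_of_tendsto_cofinite_zero
    rw [tendsto_subtype_rng]
    exact h0
  exact hs.map L.subtype.toAddMonoidHom continuous_subtype_val

theorem norm_prod_one_add_sub_one_lt {f : ι → K} {δ : ℝ} (hδ : 0 < δ) (hδ1 : δ ≤ 1)
    (s : Finset ι) (hs : ∀ i ∈ s, ‖f i‖ < δ) : ‖∏ i ∈ s, (1 + f i) - 1‖ < δ := by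
  classical
  induction s using Finset.induction_on with
  | empty => simpa
  | insert a s ha ih =>
    have h1 := ih fun i hi => hs i (Finset.mem_insert_of_mem hi)
    have h2 := hs a (Finset.mem_insert_self _ _)
    rw [Finset.prod_insert ha, show (1 + f a) * ∏ i ∈ s, (1 + f i) - 1 =
      (1 + f a) * (∏ i ∈ s, (1 + f i) - 1) + f a by ring]
    refine (IsUltrametricDist.norm_add_le_max _ _).trans_lt (max_lt ?_ h2)
    rw [norm_mul]
    refine lt_of_le_of_lt (mul_le_of_le_one_left (norm_nonneg _) ?_) h1
    exact (IsUltrametricDist.norm_add_le_max _ _).trans (by simp [(h2.trans_le hδ1).le])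

/-- If a family in a complete subfield tends to zero, then `∏ (1 + f i)` converges. -/
theorem multipliable_one_add_of_mem_of_tendsto_zero {L : Subfield K} (hL : IsComplete (L : Set K))
    {f : ι → K} (hf : ∀ i, f i ∈ L) (h0 : Tendsto f cofinite (𝓝 0)) :
    Multipliable fun i => 1 + f i := by
  classical
  have hfin : ∀ δ > 0, {i | ¬ ‖f i‖ < δ}.Finite := fun δ hδ => by
    have := (tendsto_zero_iff_norm_tendsto_zero.1 h0).eventually (gt_mem_nhds hδ)
    exact eventually_cofinite.1 this
  have hc : CauchySeq fun s : Finset ι => ∏ i ∈ s, (1 + f i) := by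
    rw [Metric.cauchySeq_iff']
    intro ε hε
    -- Only the factors indexed by `s₁` can have norm above 1, so `C` bounds every partial product
    -- containing them.
    set s₁ := (hfin 1 one_pos).toFinset with hs₁
    set C := ‖∏ i ∈ s₁, (1 + f i)‖ with hC
    have hC0 : 0 ≤ C := norm_nonneg _
    set δ := min 1 (ε / (C + 1)) with hδ
    have hδ0 : 0 < δ := lt_min one_pos (by positivity)
    refine ⟨(hfin δ hδ0).toFinset, fun s hs => ?_⟩
    set s₀ := (hfin δ hδ0).toFinset with hs₀
    have h10 : s₁ ⊆ s₀ := fun i hi => by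
      simp only [hs₁, hs₀, Set.Finite.mem_toFinset, Set.mem_ofPred_eq, not_lt] at hi ⊢
      exact (min_le_left _ _).trans hi
    have hnorm : ‖∏ i ∈ s₀, (1 + f i)‖ ≤ C := by
      rw [← Finset.prod_sdiff h10, norm_mul, norm_prod]
      refine mul_le_of_le_one_left hC0 (Finset.prod_le_one (fun _ _ => norm_nonneg _) ?_)
      intro i hi
      have hi : ‖f i‖ < 1 := by
        by_contra h
        exact (Finset.mem_sdiff.1 hi).2 (by simpa [hs₁] using h)
      exact (IsUltrametricDist.norm_add_le_max _ _).trans (by simp [hi.le])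
    have htail : ‖∏ i ∈ s \ s₀, (1 + f i) - 1‖ < δ := by
      refine norm_prod_one_add_sub_one_lt hδ0 (min_le_left _ _) _ fun i hi => ?_
      by_contra h
      exact (Finset.mem_sdiff.1 hi).2 (by simpa [hs₀] using h)
    rw [dist_eq_norm, ← Finset.prod_sdiff hs, ← sub_one_mul, norm_mul]
    calc _ ≤ ‖∏ i ∈ s \ s₀, (1 + f i) - 1‖ * C := by gcongr
      _ ≤ δ * C := by gcongr
      _ ≤ ε / (C + 1) * C := by gcongr; exact min_le_right _ _
      _ < ε := by
        rw [div_mul_eq_mul_div, div_lt_iff₀ (by positivity)]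
        nlinarith
  obtain ⟨a, -, ha⟩ := cauchySeq_tendsto_of_isComplete hL
    (fun s => prod_mem fun i _ => add_mem L.one_mem (hf i)) hc
  exact ⟨a, by simpa [HasProd] using ha⟩

omit [IsUltrametricDist K] in
/-- A limit of sums of elements of a complete subfield lies in it. -/
theorem mem_of_hasSum {L : Subfield K} (hL : IsComplete (L : Set K)) {f : ι → K} {a : K}
    (hf : ∀ i, f i ∈ L) (h : HasSum f a) : a ∈ L :=
  hL.isClosed.mem_of_tendsto h (Eventually.of_forall fun _ => sum_mem fun i _ => hf i)

-- Outside finitely many rows the bound `G` makes every entry small; each remaining row has finitely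
-- many large entries.
omit [IsUltrametricDist K] in
theorem tendsto_cofinite_prod_of_norm_le {f : ι × κ → K} {G : ι → ℝ}
    (hG : Tendsto G cofinite (𝓝 0)) (hfG : ∀ a b, ‖f (a, b)‖ ≤ G a)
    (hf : ∀ a, Tendsto (fun b => f (a, b)) cofinite (𝓝 0)) : Tendsto f cofinite (𝓝 0) := by
  rw [tendsto_zero_iff_norm_tendsto_zero, Metric.tendsto_nhds]
  intro ε hε
  have hA : {a | ¬ G a < ε}.Finite := eventually_cofinite.1 (hG.eventually (gt_mem_nhds hε))
  have hB : ∀ a, {b | ¬ ‖f (a, b)‖ < ε}.Finite := fun a => eventually_cofinite.1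
    ((tendsto_zero_iff_norm_tendsto_zero.1 (hf a)).eventually (gt_mem_nhds hε))
  rw [eventually_cofinite]
  refine (hA.biUnion fun a _ => (Set.finite_singleton a).prod (hB a)).subset ?_
  rintro ⟨a, b⟩ hab
  simp only [dist_zero_right, norm_norm, Set.mem_ofPred_eq] at hab
  simp only [Set.mem_iUnion, Set.mem_prod, Set.mem_singleton_iff, Set.mem_ofPred_eq, exists_prop]
  exact ⟨a, fun h => hab ((hfG a b).trans_lt h), rfl, hab⟩

end Ultrametric

/-! ### Partial fractions for a finite additive subgroup -/

section FiniteSubgroup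

open Polynomial

variable {G K : Type*} [AddCommGroup G] [Fintype G] [Field K] (g : G →+ K)

/-- The derivative of `∏ (X - v)`, for `v` in a finite subgroup, is constant. -/
theorem derivative_prod_X_sub_C (hg : Function.Injective g) :
    derivative (∏ v : G, (X - C (g v))) =
      C ((derivative (∏ v : G, (X - C (g v)))).eval 0) := by
  set P := ∏ v : G, (X - C (g v)) with hP
  -- Translation by `g w` permutes the roots, so `P'` takes the value `P'(0)` at `|G|` points, more
  -- than its degree.
  have hshift : ∀ w, P.comp (X + C (g w)) = P := fun w => by
    rw [hP, prod_comp]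
    refine Fintype.prod_equiv (Equiv.subRight w) _ _ fun v => ?_
    simp only [sub_comp, X_comp, C_comp, Equiv.subRight_apply, map_sub]
    ring
  have hper : ∀ w, (derivative P).eval (g w) = (derivative P).eval 0 := fun w => by
    have h := congrArg (fun p => (derivative p).eval 0) (hshift w)
    simpa [derivative_comp] using h
  have hdeg : P.natDegree = Fintype.card G := by
    rw [hP, natDegree_finsetProd_X_sub_C_eq_card]; rfl
  rw [← sub_eq_zero]
  refine eq_zero_of_natDegree_lt_card_of_eval_eq_zero _ hg (fun w => by simp [hper]) ?_
  rw [natDegree_sub_C]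
  have h0 : P.natDegree ≠ 0 := hdeg ▸ Fintype.card_ne_zero
  exact hdeg ▸ natDegree_derivative_lt h0

/-- Partial fractions of the inverse of `z * ∏ (1 - z / v)`, for a finite subgroup. -/
theorem sum_inv_sub_mul_prod [DecidableEq G] (hg : Function.Injective g) {z : K}
    (hz : ∀ v, z ≠ g v) :
    (∑ v : G, (z - g v)⁻¹) * (z * ∏ v ∈ Finset.univ.erase 0, (1 - z / g v)) = 1 := by
  have h0 : ∀ v ∈ Finset.univ.erase (0 : G), g v ≠ 0 := fun v hv h =>
    (Finset.mem_erase.1 hv).1 (hg (h.trans (map_zero g).symm))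
  have hsum : ∀ x, (derivative (∏ v : G, (X - C (g v)))).eval x =
      ∑ v : G, ∏ w ∈ Finset.univ.erase v, (x - g w) := fun x => by
    rw [derivative_prod_finset]
    simp [eval_finsetSum, eval_prod]
  -- The sum of inverses is `P'(z)/P(z) = P'(0)/P(z)`, and `P'(0)` is exactly the constant
  -- normalizing `P` to `z ∏ (1 - z/v)`.
  have hz0 : (derivative (∏ v : G, (X - C (g v)))).eval z =
      (derivative (∏ v : G, (X - C (g v)))).eval 0 := by
    rw [derivative_prod_X_sub_C g hg, eval_C, eval_C]
  have hR : (∑ v : G, ∏ w ∈ Finset.univ.erase v, (0 - g w)) =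
      ∏ w ∈ Finset.univ.erase 0, (0 - g w) := by
    refine Finset.sum_eq_single 0 (fun v _ hv => ?_) (by simp)
    exact Finset.prod_eq_zero (Finset.mem_erase.2 ⟨hv.symm, Finset.mem_univ _⟩) (by simp)
  have hLd : (∑ v : G, ∏ w ∈ Finset.univ.erase v, (z - g w)) =
      (∑ v : G, (z - g v)⁻¹) * ∏ w : G, (z - g w) := by
    rw [Finset.sum_mul]
    refine Finset.sum_congr rfl fun v _ => ?_
    rw [← Finset.mul_prod_erase _ _ (Finset.mem_univ v),
      inv_mul_cancel_left₀ (sub_ne_zero.2 (hz v))]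
  have hprod : z * ∏ v ∈ Finset.univ.erase 0, (1 - z / g v) =
      (∏ w : G, (z - g w)) / ∏ w ∈ Finset.univ.erase 0, (0 - g w) := by
    rw [← Finset.mul_prod_erase _ _ (Finset.mem_univ (0 : G)), mul_div_assoc,
      ← Finset.prod_div_distrib, map_zero, sub_zero]
    congr 1
    refine Finset.prod_congr rfl fun v hv => ?_
    have := h0 v hv
    field_simp
    ring
  rw [hprod, ← mul_div_assoc, ← hLd, ← hsum z, hz0, hsum 0, hR, div_self]
  exact Finset.prod_ne_zero_iff.2 fun v hv => by simpa using h0 v hv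

end FiniteSubgroup

/-! ### The lattice exponential, its partial fractions and its expansion at zero -/

section Lattice

variable {F K : Type*} [Field F] [NormedField K]

/-- `φ` embeds `F[X]` as a discrete subring in a field exhausted by complete subfields. -/
structure IsDiscreteHom (φ : F[X] →+* K) : Prop where
  one_le_norm : ∀ A, A ≠ 0 → 1 ≤ ‖φ A‖
  tendsto_cobounded : Tendsto φ cofinite (Bornology.cobounded K)
  exists_isComplete : ∀ x y : K, ∃ L : Subfield K,
    IsComplete (L : Set K) ∧ x ∈ L ∧ y ∈ L ∧ ∀ A, φ A ∈ L

/-- The exponential of the lattice `ϖ * φ F[X]`. -/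
def latticeExp (φ : F[X] →+* K) (ϖ z : K) : K :=
  z * ∏' A : {A : F[X] // A ≠ 0}, (1 - z / (ϖ * φ A))

/-- The power sum `∑ (ϖ B)⁻ᵐ` over the nonzero points of the lattice. -/
def latticeZeta (φ : F[X] →+* K) (ϖ : K) (m : ℕ) : K :=
  ∑' B : {B : F[X] // B ≠ 0}, ((ϖ * φ B)⁻¹) ^ m

theorem hasSum_ne_zero_iff {ι : Type*} [Zero ι] {f : ι → K} {a : K} :
    HasSum (fun b : {b : ι // b ≠ 0} => f b) a ↔ HasSum f (f 0 + a) := by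
  have h : HasSum (f ∘ ((↑) : ({0} : Set ι) → ι)) (f 0) := by
    simpa using hasSum_fintype (f ∘ ((↑) : ({0} : Set ι) → ι))
  exact h.hasSum_compl_iff

variable {φ : F[X] →+* K} {ϖ : K}

namespace IsDiscreteHom

theorem ne_zero (hφ : IsDiscreteHom φ) {A : F[X]} (hA : A ≠ 0) : φ A ≠ 0 :=
  norm_pos_iff.1 (one_pos.trans_le (hφ.one_le_norm A hA))

theorem mul_ne_zero (hφ : IsDiscreteHom φ) (hϖ : ϖ ≠ 0) {A : F[X]} (hA : A ≠ 0) : ϖ * φ A ≠ 0 :=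
  _root_.mul_ne_zero hϖ (hφ.ne_zero hA)

theorem norm_le_norm_mul (hφ : IsDiscreteHom φ) (ϖ : K) {A : F[X]} (hA : A ≠ 0) :
    ‖ϖ‖ ≤ ‖ϖ * φ A‖ := by
  rw [norm_mul]
  exact le_mul_of_one_le_right (norm_nonneg _) (hφ.one_le_norm A hA)

theorem norm_inv_le (hφ : IsDiscreteHom φ) (hϖ : ϖ ≠ 0) {A : F[X]} (hA : A ≠ 0) :
    ‖(ϖ * φ A)⁻¹‖ ≤ ‖ϖ‖⁻¹ := by
  rw [norm_inv]
  exact inv_anti₀ (norm_pos_iff.2 hϖ) (hφ.norm_le_norm_mul ϖ hA)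

theorem tendsto_inv_sub (hφ : IsDiscreteHom φ) (hϖ : ϖ ≠ 0) (z : K) :
    Tendsto (fun B => (z - ϖ * φ B)⁻¹) cofinite (𝓝 0) := by
  refine tendsto_inv₀_cobounded.comp ?_
  have h := (tendsto_mul_left_cobounded hϖ).comp hφ.tendsto_cobounded
  rw [← tendsto_norm_atTop_iff_cobounded] at h ⊢
  refine tendsto_atTop_mono (fun B => ?_) (tendsto_atTop_add_const_right _ (-‖z‖) h)
  have := norm_sub_norm_le (ϖ * φ B) z
  rw [norm_sub_rev]
  simpa [sub_eq_add_neg] using this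

theorem tendsto_inv (hφ : IsDiscreteHom φ) (hϖ : ϖ ≠ 0) :
    Tendsto (fun B : {B : F[X] // B ≠ 0} => (ϖ * φ B)⁻¹) cofinite (𝓝 0) := by
  have h := ((hφ.tendsto_inv_sub hϖ 0).comp Subtype.val_injective.tendsto_cofinite).neg
    (f := fun B : {B : F[X] // B ≠ 0} => _)
  simpa [Function.comp_def, inv_neg] using h

theorem tendsto_inv_pow (hφ : IsDiscreteHom φ) (hϖ : ϖ ≠ 0) {m : ℕ} (hm : m ≠ 0) :
    Tendsto (fun B : {B : F[X] // B ≠ 0} => ((ϖ * φ B)⁻¹) ^ m) cofinite (𝓝 0) := by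
  simpa [hm] using (hφ.tendsto_inv hϖ).pow m

variable [IsUltrametricDist K]

theorem hasSum_latticeZeta (hφ : IsDiscreteHom φ) (hϖ : ϖ ≠ 0) {m : ℕ} (hm : m ≠ 0) :
    HasSum (fun B : {B : F[X] // B ≠ 0} => ((ϖ * φ B)⁻¹) ^ m) (latticeZeta φ ϖ m) := by
  obtain ⟨L, hL, hϖL, -, hφL⟩ := hφ.exists_isComplete ϖ ϖ
  exact (summable_of_mem_of_tendsto_zero hL
    (fun B : {B : F[X] // B ≠ 0} => pow_mem (inv_mem (mul_mem hϖL (hφL B))) m) (hφ.tendsto_inv_pow hϖ hm)).hasSum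

theorem summable_inv_sub (hφ : IsDiscreteHom φ) (hϖ : ϖ ≠ 0) (z : K) :
    Summable fun B => (z - ϖ * φ B)⁻¹ := by
  obtain ⟨L, hL, hϖL, hzL, hφL⟩ := hφ.exists_isComplete ϖ z
  exact summable_of_mem_of_tendsto_zero hL
    (fun B => inv_mem (sub_mem hzL (mul_mem hϖL (hφL B)))) (hφ.tendsto_inv_sub hϖ z)

theorem multipliable_one_sub (hφ : IsDiscreteHom φ) (hϖ : ϖ ≠ 0) (z : K) :
    Multipliable fun A : {A : F[X] // A ≠ 0} => (1 - z / (ϖ * φ A)) := by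
  obtain ⟨L, hL, hϖL, hzL, hφL⟩ := hφ.exists_isComplete ϖ z
  simp_rw [sub_eq_add_neg]
  refine multipliable_one_add_of_mem_of_tendsto_zero hL
    (fun B => neg_mem (div_mem hzL (mul_mem hϖL (hφL B)))) ?_
  simpa [div_eq_mul_inv] using ((hφ.tendsto_inv hϖ).const_mul z).neg

variable [Fintype F]

/-- The partial fraction expansion of `1 / e`. -/
theorem tsum_inv_sub_mul_latticeExp (hφ : IsDiscreteHom φ) (hϖ : ϖ ≠ 0) {z : K}
    (hz : ∀ B, z ≠ ϖ * φ B) : (∑' B, (z - ϖ * φ B)⁻¹) * latticeExp φ ϖ z = 1 := by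
  classical
  -- The polynomials of degree `< d` form finite subgroups exhausting `F[X]`; along them the product
  -- of partial sum and partial product is exactly 1.
  let V : ℕ → Submodule F F[X] := fun d => Polynomial.degreeLT F d
  have hV : ∀ d, Finite (V d) := fun d =>
    Finite.of_equiv _ (Polynomial.degreeLTEquiv F d).symm.toEquiv
  let s : ℕ → Finset F[X] := fun d => (Set.toFinite (V d : Set F[X])).toFinset
  let t : ℕ → Finset {A : F[X] // A ≠ 0} := fun d => (s d).subtype _
  have hs_mem : ∀ d A, A ∈ s d ↔ A.degree < d := fun d A => by
    simp [s, V, Polynomial.mem_degreeLT]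
  have hs_mono : Monotone s := fun a b hab A hA => by
    rw [hs_mem] at hA ⊢
    exact hA.trans_le (by exact_mod_cast hab)
  have hs_ex : ∀ A, ∃ d, A ∈ s d := fun A => ⟨A.natDegree + 1, by
    rw [hs_mem]
    exact Polynomial.degree_le_natDegree.trans_lt (by exact_mod_cast Nat.lt_succ_self _)⟩
  have hs : Tendsto s atTop atTop := tendsto_atTop_finset_of_monotone hs_mono hs_ex
  have ht : Tendsto t atTop atTop := tendsto_atTop_finset_of_monotone
    (fun a b hab A hA => by
      simp only [t, Finset.mem_subtype] at hA ⊢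
      exact hs_mono hab hA)
    (fun A => (hs_ex A).imp fun d hd => by simpa [t] using hd)
  have h1 := (hφ.summable_inv_sub hϖ z).hasSum.comp hs
  have h2 := ((hφ.multipliable_one_sub hϖ z).hasProd.comp ht).const_mul z
  have h3 := h1.mul h2
  refine tendsto_nhds_unique h3 (tendsto_const_nhds.congr fun d => ?_)
  have := Fintype.ofFinite (V d)
  let g : V d →+ K := (AddMonoidHom.mulLeft ϖ).comp
    (φ.toAddMonoidHom.comp (V d).subtype.toAddMonoidHom)
  have hg : Function.Injective g := by
    rw [injective_iff_map_eq_zero]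
    intro A hA
    by_contra hA0
    exact hφ.mul_ne_zero hϖ (fun h => hA0 (Subtype.ext h)) hA
  have key := sum_inv_sub_mul_prod g hg (z := z) fun v => hz v
  have e1 : ∑ B ∈ s d, (z - ϖ * φ B)⁻¹ = ∑ v : V d, (z - g v)⁻¹ :=
    Finset.sum_subtype (s d) (fun x => by simp [s]) _
  have e2 : ∏ A ∈ t d, (1 - z / (ϖ * φ A)) = ∏ v ∈ Finset.univ.erase 0, (1 - z / g v) := by
    refine Finset.prod_bij' (fun A hA => ⟨A.1, by simpa [t, s] using hA⟩)
      (fun v hv => ⟨v.1, fun h => (Finset.mem_erase.1 hv).1 (Subtype.ext h)⟩) ?_ ?_ ?_ ?_ ?_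
    · intro A hA
      simpa [Subtype.ext_iff] using A.2
    · intro v hv
      simp [t, s]
    · intros; rfl
    · intros; rfl
    · intros; rfl
  simp only [Function.comp_apply]
  rw [e1, e2, key]

theorem latticeExp_ne_zero_iff (hφ : IsDiscreteHom φ) (hϖ : ϖ ≠ 0) {z : K} :
    latticeExp φ ϖ z ≠ 0 ↔ ∀ B, z ≠ ϖ * φ B := by
  refine ⟨fun h B hB => h ?_, fun h => right_ne_zero_of_mul_eq_one
    (hφ.tsum_inv_sub_mul_latticeExp hϖ h)⟩
  by_cases hB0 : B = 0
  · simp [latticeExp, hB, hB0]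
  · have h0 := hφ.mul_ne_zero hϖ hB0
    rw [latticeExp, tprod_of_exists_eq_zero ⟨⟨B, hB0⟩, by simp [hB, div_self h0]⟩, mul_zero]

theorem hasSum_inv_sub (hφ : IsDiscreteHom φ) (hϖ : ϖ ≠ 0) {z : K}
    (hz : ∀ B, z ≠ ϖ * φ B) : HasSum (fun B => (z - ϖ * φ B)⁻¹) (latticeExp φ ϖ z)⁻¹ := by
  have h := (hφ.summable_inv_sub hϖ z).hasSum
  rwa [eq_inv_of_mul_eq_one_left (hφ.tsum_inv_sub_mul_latticeExp hϖ hz)] at h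

theorem hasSum_inv_sub_ne_zero (hφ : IsDiscreteHom φ) (hϖ : ϖ ≠ 0) {z : K}
    (hz : ∀ B, z ≠ ϖ * φ B) :
    HasSum (fun B : {B : F[X] // B ≠ 0} => (z - ϖ * φ B)⁻¹) ((latticeExp φ ϖ z)⁻¹ - z⁻¹) := by
  rw [hasSum_ne_zero_iff (f := fun B => (z - ϖ * φ B)⁻¹)]
  simpa using hφ.hasSum_inv_sub hϖ hz

/-- The coefficients of the expansion of `z / e(z)` at zero. -/
theorem hasSum_div_latticeExp (hφ : IsDiscreteHom φ) {z : K} (hz0 : z ≠ 0) (hz : ‖z‖ < ‖ϖ‖) :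
    HasSum (fun m => (if m = 0 then 1 else -latticeZeta φ ϖ m) * z ^ m)
      (z / latticeExp φ ϖ z) := by
  have hϖ : ϖ ≠ 0 := norm_pos_iff.1 ((norm_nonneg z).trans_lt hz)
  have hlt : ∀ B : {B : F[X] // B ≠ 0}, ‖z * (ϖ * φ B)⁻¹‖ ≤ ‖z‖ * ‖ϖ‖⁻¹ := fun B => by
    rw [norm_mul]
    exact mul_le_mul_of_nonneg_left (hφ.norm_inv_le hϖ B.2) (norm_nonneg _)
  have hr : ‖z‖ * ‖ϖ‖⁻¹ < 1 := by
    rw [← div_eq_mul_inv, div_lt_one (norm_pos_iff.2 hϖ)]; exact hz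
  have hzB : ∀ B, z ≠ ϖ * φ B := fun B h => by
    by_cases hB : B = 0
    · exact hz0 (by simpa [hB] using h)
    · exact (h ▸ hz).not_ge (hφ.norm_le_norm_mul ϖ hB)
  obtain ⟨L, hL, hϖL, hzL, hφL⟩ := hφ.exists_isComplete ϖ z
  -- Summing this double family over `B` first gives the power sums; over the exponent first,
  -- geometric series with values `-z/(z - ϖB)`.
  have hS : Summable fun p : ℕ × {B : F[X] // B ≠ 0} => (z * (ϖ * φ p.2)⁻¹) ^ (p.1 + 1) := by
    refine summable_of_mem_of_tendsto_zero hL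
      (fun p => pow_mem (mul_mem hzL (inv_mem (mul_mem hϖL (hφL _)))) _)
      (tendsto_cofinite_prod_of_norm_le (G := fun m => (‖z‖ * ‖ϖ‖⁻¹) ^ (m + 1)) ?_ ?_ ?_)
    · rw [Nat.cofinite_eq_atTop]
      exact (tendsto_pow_atTop_nhds_zero_of_lt_one (by positivity) hr).comp (tendsto_add_atTop_nat 1)
    · intro m B
      rw [norm_pow]
      exact pow_le_pow_left₀ (norm_nonneg _) (hlt B) _
    · intro m
      simpa using ((hφ.tendsto_inv hϖ).const_mul z).pow (m + 1)
  have h1 := hS.hasSum.prod_fiberwise (g := fun m => latticeZeta φ ϖ (m + 1) * z ^ (m + 1)) fun m => by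
    simpa [mul_pow, mul_comm] using (hφ.hasSum_latticeZeta hϖ m.succ_ne_zero).mul_left (z ^ (m + 1))
  have h2 := ((Equiv.prodComm _ _).hasSum_iff.2 hS.hasSum).prod_fiberwise
    (g := fun B : {B : F[X] // B ≠ 0} => -z * (z - ϖ * φ B)⁻¹) fun B => by
      have hg := (hasSum_geometric_of_norm_lt_one ((hlt B).trans_lt hr)).mul_left (z * (ϖ * φ B)⁻¹)
      have e : ∀ w, w ≠ 0 → z * w⁻¹ * (1 - z * w⁻¹)⁻¹ = -z * (z - w)⁻¹ := fun w h0 => by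
        rw [show 1 - z * w⁻¹ = -((z - w) * w⁻¹) by rw [sub_mul, mul_inv_cancel₀ h0]; ring,
          inv_neg, mul_inv, inv_inv]
        field_simp
      rw [e _ (hφ.mul_ne_zero hϖ B.2)] at hg
      simpa [pow_succ'] using hg
  have h3 := h2.unique ((hφ.hasSum_inv_sub_ne_zero hϖ hzB).mul_left (-z))
  rw [h3] at h1
  have h4 : HasSum (fun m => (if m + 1 = 0 then 1 else -latticeZeta φ ϖ (m + 1)) * z ^ (m + 1))
      (z / latticeExp φ ϖ z - 1) := by
    have e : z / latticeExp φ ϖ z - 1 = -(-z * ((latticeExp φ ϖ z)⁻¹ - z⁻¹)) := by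
      rw [neg_mul, neg_neg, mul_sub, mul_inv_cancel₀ hz0, div_eq_mul_inv]
    rw [e]
    simpa only [Nat.succ_ne_zero, if_false, neg_mul] using h1.neg
  rw [← hasSum_nat_add_iff' 1]
  simpa using h4

end IsDiscreteHom

end Lattice

/-! ### Uniqueness of power series coefficients -/

section PowerSeries

variable {K : Type*} [NontriviallyNormedField K]

/-- The coefficients of a power series are determined by its sum near zero. -/
theorem coeff_unique {f : K → K} {c d : ℕ → K}
    (hc : ∀ᶠ z in 𝓝[≠] (0 : K), HasSum (fun m => c m * z ^ m) (f z))
    (hd : ∀ᶠ z in 𝓝[≠] (0 : K), HasSum (fun m => d m * z ^ m) (f z)) : c = d := by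
  -- The difference is multiplied by `z`: the hypotheses say nothing at `z = 0`, where the shifted
  -- series visibly sums to zero.
  let p : FormalMultilinearSeries K K K := FormalMultilinearSeries.ofScalars K
    fun m => m.casesOn 0 fun m => c m - d m
  have hp : HasFPowerSeriesAt 0 p 0 := by
    rw [hasFPowerSeriesAt_iff]
    rw [eventually_nhdsWithin_iff] at hc hd
    filter_upwards [hc, hd] with z hcz hdz
    rw [← hasSum_nat_add_iff' 1]
    by_cases hz : z = 0
    · simp [hz, p, FormalMultilinearSeries.coeff_ofScalars]
    · simpa [p, FormalMultilinearSeries.coeff_ofScalars, pow_succ, sub_mul, mul_comm, mul_assoc,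
        mul_left_comm, mul_sub] using ((hcz hz).sub (hdz hz)).mul_left z
  have h0 := hp.eq_zero
  ext m
  have := congrArg (fun p => p.coeff (m + 1)) h0
  have hz : (0 : FormalMultilinearSeries K K K).coeff (m + 1) = 0 := rfl
  simpa [p, FormalMultilinearSeries.coeff_ofScalars, sub_eq_zero, hz] using this

end PowerSeries

/-! ### The action of `Fˣ`: nonzero versus monic polynomials -/

section Scaling

variable {F : Type*} [Field F]

/-- Multiplication of the nonzero polynomials by a nonzero constant. -/
def scaleEquiv (c : Fˣ) : {A : F[X] // A ≠ 0} ≃ {A : F[X] // A ≠ 0} where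
  toFun A := ⟨Polynomial.C (c : F) * A, mul_ne_zero (by simp) A.2⟩
  invFun A := ⟨Polynomial.C ((c⁻¹ : Fˣ) : F) * A, mul_ne_zero (by simp) A.2⟩
  left_inv A := Subtype.ext <| by simp [← mul_assoc, ← Polynomial.C_mul]
  right_inv A := Subtype.ext <| by simp [← mul_assoc, ← Polynomial.C_mul]

/-- A nonzero polynomial is the product of its leading coefficient and a monic polynomial. -/
def monicEquiv : Fˣ × Monic₁ F ≃ {A : F[X] // A ≠ 0} where
  toFun p := ⟨Polynomial.C (p.1 : F) * p.2, mul_ne_zero (by simp) p.2.2.ne_zero⟩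
  invFun A := ⟨Units.mk0 A.1.leadingCoeff (by simpa using A.2),
    ⟨Polynomial.C A.1.leadingCoeff⁻¹ * A, by
      rw [mul_comm]; exact Polynomial.monic_mul_leadingCoeff_inv A.2⟩⟩
  left_inv p := by
    have h : (Polynomial.C (p.1 : F) * (p.2 : F[X])).leadingCoeff = p.1 := by
      simp [Polynomial.leadingCoeff_mul, p.2.2.leadingCoeff]
    ext
    · simpa using h
    · simp [p.2.2.leadingCoeff, ← mul_assoc, ← Polynomial.C_mul]
  right_inv A := Subtype.ext <| by
    have : A.1.leadingCoeff ≠ 0 := by simpa using A.2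
    simp [← mul_assoc, ← Polynomial.C_mul, this]

variable [Fintype F] {K : Type*} [NormedField K]

/-- In characteristic dividing `q`, a scaling invariant sum over the nonzero polynomials is `-1`
times the sum over the monic ones. -/
theorem hasSum_monic (φ : F[X] →+* K) {f : F[X] → K} (hf : ∀ (c : Fˣ) A, f (Polynomial.C (c : F) * A) = f A) {a : K}
    (h : HasSum (fun A : {A : F[X] // A ≠ 0} => f A) a) :
    HasSum (fun A : Monic₁ F => f A) (-a) := by
  classical
  have hcard : ((Fintype.card Fˣ : ℕ) : K) = -1 := by
    have h0 : ((q F : ℕ) : F) = 0 := FiniteField.cast_card_eq_zero F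
    have h1 := congrArg (φ.comp Polynomial.C) h0
    rw [map_natCast, map_zero] at h1
    rw [Fintype.card_units, Nat.cast_sub Fintype.card_pos, h1]
    simp
  have h2 := (((Equiv.prodComm _ _).trans monicEquiv).hasSum_iff.2 h).prod_fiberwise
    (g := fun A : Monic₁ F => -f A) fun A => by
      simpa [monicEquiv, hf, hcard] using hasSum_fintype fun _ : Fˣ => f A
  simpa using h2.neg

theorem tendsto_cofinite_of_monic {f : F[X] → K}
    (hf : ∀ (c : Fˣ) A, f (Polynomial.C (c : F) * A) = f A)
    (h : Tendsto (fun A : Monic₁ F => f A) cofinite (𝓝 0)) :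
    Tendsto (fun A : {A : F[X] // A ≠ 0} => f A) cofinite (𝓝 0) := by
  have h1 : Tendsto (Prod.snd : Fˣ × Monic₁ F → Monic₁ F) cofinite cofinite :=
    Tendsto.cofinite_of_finite_preimage_singleton fun A =>
      ((Set.finite_univ (α := Fˣ)).prod (Set.finite_singleton A)).subset fun p hp => ⟨trivial, hp⟩
  have h2 := (h.comp h1).comp monicEquiv.symm.injective.tendsto_cofinite
  refine h2.congr fun A => ?_
  obtain ⟨p, rfl⟩ := monicEquiv.surjective A
  simp [monicEquiv, hf, p.2.2.leadingCoeff, ← mul_assoc, ← Polynomial.C_mul]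

variable {φ : F[X] →+* K}

theorem map_C_pow_eq_one (c : Fˣ) {m : ℕ} (hm : q F - 1 ∣ m) :
    φ (Polynomial.C (c : F)) ^ m = 1 := by
  rw [← map_pow, ← Polynomial.C_pow, ← Units.val_pow_eq_pow_val,
    (FiniteField.forall_pow_eq_one_iff F m).2 hm c]
  simp

/-- Reindexing by a unit `c` with `c ^ m ≠ 1` multiplies the sum by `c⁻ᵐ`. No convergence is needed,
since `tsum` respects bijections and constant factors in any case. -/
theorem latticeZeta_eq_zero (ϖ : K) {m : ℕ} (hm : ¬ q F - 1 ∣ m) : latticeZeta φ ϖ m = 0 := by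
  obtain ⟨c, hc⟩ := not_forall.1 (mt (FiniteField.forall_pow_eq_one_iff F m).1 hm)
  have h : latticeZeta φ ϖ m = (φ (Polynomial.C (c : F)))⁻¹ ^ m * latticeZeta φ ϖ m := by
    conv_lhs => rw [latticeZeta, ← (scaleEquiv c).tsum_eq]
    rw [latticeZeta, ← tsum_mul_left]
    congr 1
    ext A
    simp only [scaleEquiv, Equiv.coe_fn_mk, map_mul, mul_inv, mul_pow]
    ring
  by_contra h0
  refine hc ?_
  have h1 : (φ (Polynomial.C (c : F))) ^ m = 1 := by
    simpa using (mul_right_cancel₀ h0 ((one_mul _).trans h)).symm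
  rw [← map_pow, ← Polynomial.C_pow] at h1
  have h2 : (φ.comp Polynomial.C) ((c : F) ^ m) = (φ.comp Polynomial.C) 1 := by
    simpa using h1
  exact Units.ext (by simpa using (φ.comp Polynomial.C).injective h2)

omit [Fintype F] in
theorem latticeExp_C_mul (ϖ z : K) (c : Fˣ) :
    latticeExp φ ϖ (φ (Polynomial.C (c : F)) * z) =
      φ (Polynomial.C (c : F)) * latticeExp φ ϖ z := by
  rw [latticeExp, latticeExp, mul_assoc]
  congr 2
  conv_lhs => rw [← (scaleEquiv c).tprod_eq]
  congr 1
  ext A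
  have hc : φ (Polynomial.C (c : F)) ≠ 0 := by
    intro h
    exact c.ne_zero ((map_eq_zero (φ.comp Polynomial.C)).1 h)
  simp only [scaleEquiv, Equiv.coe_fn_mk, map_mul]
  rw [mul_left_comm, mul_div_mul_left _ _ hc]

omit [Fintype F] in
theorem latticeZeta_eq_mul {ϖ : K} (hϖ : ϖ ≠ 0) (α : K) (m : ℕ) :
    latticeZeta φ α m = (ϖ / α) ^ m * latticeZeta φ ϖ m := by
  rw [latticeZeta, latticeZeta, ← tsum_mul_left]
  congr 1
  ext B
  rw [← mul_pow]
  congr 1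
  rw [mul_inv, mul_inv, div_eq_mul_inv]
  field_simp

end Scaling

/-! ### The double series and the reciprocity between `α` and `β` -/

section Reciprocity

theorem norm_sub_le_max {K : Type*} [NormedField K] [IsUltrametricDist K] (x y : K) :
    ‖x - y‖ ≤ max ‖x‖ ‖y‖ := by
  simpa [sub_eq_add_neg] using IsUltrametricDist.norm_add_le_max x (-y)

/-- Iterates `x⁻¹(x-y)⁻¹ = y⁻¹(x-y)⁻¹ - x⁻¹y⁻¹`, moving the pole of order `N` from `x` to `y`. -/
theorem inv_pow_mul_inv_sub {K : Type*} [Field K] {x y : K} (hx : x ≠ 0) (hy : y ≠ 0) (hxy : x - y ≠ 0)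
    (N : ℕ) :
    x⁻¹ ^ N * (x - y)⁻¹ + ∑ i ∈ Finset.range N, x⁻¹ ^ (i + 1) * y⁻¹ ^ (N - i) =
      y⁻¹ ^ N * (x - y)⁻¹ := by
  induction N with
  | zero => simp
  | succ N ih =>
    rw [Finset.sum_range_succ]
    have h : ∑ i ∈ Finset.range N, x⁻¹ ^ (i + 1) * y⁻¹ ^ (N + 1 - i) =
        y⁻¹ * ∑ i ∈ Finset.range N, x⁻¹ ^ (i + 1) * y⁻¹ ^ (N - i) := by
      rw [Finset.mul_sum]
      refine Finset.sum_congr rfl fun i hi => ?_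
      rw [Nat.sub_add_comm (Finset.mem_range.1 hi).le, pow_succ y⁻¹]
      ring
    rw [h, eq_sub_of_add_eq' ih, Nat.add_sub_cancel_left]
    have key : x⁻¹ * (x - y)⁻¹ - y⁻¹ * (x - y)⁻¹ + x⁻¹ * y⁻¹ = 0 := by
      field_simp
      ring
    linear_combination x⁻¹ ^ N * key

variable {F K : Type*} [Field F] [NormedField K] {φ : F[X] →+* K} {ϖ α β : K}

/-- The summand `(α A)⁻ᴺ / e(α A)`. -/
def expTerm (φ : F[X] →+* K) (ϖ : K) (N : ℕ) (α : K) (A : F[X]) : K :=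
  (α * φ A)⁻¹ ^ N * (latticeExp φ ϖ (α * φ A))⁻¹

theorem expTerm_C_mul [Fintype F] {N : ℕ} (hN : q F - 1 ∣ N + 1) (c : Fˣ) (A : F[X]) :
    expTerm φ ϖ N α (Polynomial.C (c : F) * A) = expTerm φ ϖ N α A := by
  have h := map_C_pow_eq_one (φ := φ) c hN
  rw [expTerm, expTerm, map_mul, mul_left_comm, latticeExp_C_mul]
  calc _ = (φ (Polynomial.C (c : F)) ^ (N + 1))⁻¹ *
        ((α * φ A)⁻¹ ^ N * (latticeExp φ ϖ (α * φ A))⁻¹) := by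
        simp only [mul_inv, mul_pow, pow_succ, inv_pow]; ring
    _ = _ := by rw [h, inv_one, one_mul]

/-- The coefficients of the expansion of `z / e(z)`. -/
def expCoeff (φ : F[X] →+* K) (ϖ : K) (m : ℕ) : K :=
  if m = 0 then 1 else -latticeZeta φ ϖ m

variable [IsUltrametricDist K] [Fintype F]

namespace IsDiscreteHom

theorem inv_latticeExp_mem (hφ : IsDiscreteHom φ) (hϖ : ϖ ≠ 0) {L : Subfield K}
    (hL : IsComplete (L : Set K)) (hϖL : ϖ ∈ L) (hφL : ∀ A, φ A ∈ L) {z : K} (hzL : z ∈ L) :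
    (latticeExp φ ϖ z)⁻¹ ∈ L := by
  by_cases hz : latticeExp φ ϖ z = 0
  · simp [hz]
  · exact mem_of_hasSum hL (fun B => inv_mem (sub_mem hzL (mul_mem hϖL (hφL B))))
      (hφ.hasSum_inv_sub hϖ ((hφ.latticeExp_ne_zero_iff hϖ).1 hz))

theorem summable_expTerm (hφ : IsDiscreteHom φ) (hϖ : ϖ ≠ 0) {N : ℕ}
    (h : Tendsto (fun A : {A : F[X] // A ≠ 0} => expTerm φ ϖ N α A) cofinite (𝓝 0)) :
    Summable fun A : {A : F[X] // A ≠ 0} => expTerm φ ϖ N α A := by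
  obtain ⟨L, hL, hϖL, hαL, hφL⟩ := hφ.exists_isComplete ϖ α
  refine summable_of_mem_of_tendsto_zero hL (fun A => ?_) h
  have hA := mul_mem hαL (hφL A)
  exact mul_mem (pow_mem (inv_mem hA) _) (hφ.inv_latticeExp_mem hϖ hL hϖL hφL hA)

/-- If `α` is badly approximable by `ϖ F(T)`, the general term of the series tends to zero. -/
theorem tendsto_expTerm_of_le_norm_sub (hφ : IsDiscreteHom φ) (hϖ : ϖ ≠ 0) (hα : α ≠ 0) {N : ℕ}
    (hN : N ≠ 0) {δ : ℝ} (hδ : 0 < δ) (h : ∀ A, A ≠ 0 → ∀ B, δ ≤ ‖α * φ A - ϖ * φ B‖) :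
    Tendsto (fun A : {A : F[X] // A ≠ 0} => expTerm φ ϖ N α A) cofinite (𝓝 0) := by
  have h0 := (tendsto_zero_iff_norm_tendsto_zero.1 (hφ.tendsto_inv_pow hα hN)).mul_const δ⁻¹
  rw [zero_mul] at h0
  refine squeeze_zero_norm (fun A => ?_) h0
  have hz : ∀ B, α * φ A ≠ ϖ * φ B := fun B hB => by
    have := h A A.2 B
    rw [hB, sub_self, norm_zero] at this
    exact this.not_gt hδ
  rw [expTerm, norm_mul, ← (hφ.hasSum_inv_sub hϖ hz).tsum_eq]
  refine mul_le_mul_of_nonneg_left ?_ (norm_nonneg _)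
  refine IsUltrametricDist.norm_tsum_le_of_forall_le_of_nonneg (inv_nonneg.2 hδ.le) fun B => ?_
  rw [norm_inv]
  exact inv_anti₀ hδ (h A A.2 B)

/-- Lattice points are `‖ϖ‖`-separated, so at most one is closer than `‖ϖ‖` to `z`. The other terms
of `1/e(z)` have norm at most `‖ϖ‖⁻¹`, so the exceptional term differs from `1/e(z)` by at most
that. Hence convergence of the single series over `A` already controls the double series. -/
theorem norm_inv_sub_le_max (hφ : IsDiscreteHom φ) (hϖ : ϖ ≠ 0) {z : K}
    (hz : ∀ B, z ≠ ϖ * φ B) (B : F[X]) :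
    ‖(z - ϖ * φ B)⁻¹‖ ≤ max ‖(latticeExp φ ϖ z)⁻¹‖ ‖ϖ‖⁻¹ := by
  classical
  rcases le_or_gt ‖(z - ϖ * φ B)⁻¹‖ ‖ϖ‖⁻¹ with h | h
  · exact le_max_of_le_right h
  have hϖ' := norm_pos_iff.2 hϖ
  rw [norm_inv, inv_lt_inv₀ hϖ' (norm_pos_iff.2 (sub_ne_zero.2 (hz B)))] at h
  have hfar : ∀ B', B' ≠ B → ‖(z - ϖ * φ B')⁻¹‖ ≤ ‖ϖ‖⁻¹ := fun B' hB' => by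
    rw [norm_inv]
    refine inv_anti₀ hϖ' ?_
    have h1 := hφ.norm_le_norm_mul ϖ (sub_ne_zero.2 hB')
    have h2 := norm_sub_rev (ϖ * φ B') (ϖ * φ B)
    rw [map_sub, mul_sub] at h1
    rw [show ϖ * φ B' - ϖ * φ B = (z - ϖ * φ B) - (z - ϖ * φ B') by ring] at h1
    exact (le_max_iff.1 (h1.trans (norm_sub_le_max _ _))).resolve_left h.not_ge
  have hs := (hφ.hasSum_inv_sub hϖ hz).sub (hasSum_ite_eq B (z - ϖ * φ B)⁻¹)
  have hle : ‖(latticeExp φ ϖ z)⁻¹ - (z - ϖ * φ B)⁻¹‖ ≤ ‖ϖ‖⁻¹ := by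
    rw [← hs.tsum_eq]
    refine IsUltrametricDist.norm_tsum_le_of_forall_le_of_nonneg (by positivity) fun B' => ?_
    by_cases hB : B' = B
    · simp [hB]
    · simpa [hB] using hfar B' hB
  calc ‖(z - ϖ * φ B)⁻¹‖ =
      ‖(latticeExp φ ϖ z)⁻¹ - ((latticeExp φ ϖ z)⁻¹ - (z - ϖ * φ B)⁻¹)‖ := by rw [sub_sub_cancel]
    _ ≤ _ := (norm_sub_le_max _ _).trans (max_le_max le_rfl hle)

/-- The reciprocity between the sums `∑ (α A)⁻ᴺ / e(α A)` and `∑ (β A)⁻ᴺ / e(β A)` over the nonzero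
polynomials, obtained by summing `(α A)⁻ᴺ / (α A - ϖ B)` in two ways. -/
theorem expTerm_reciprocity (hφ : IsDiscreteHom φ) (hϖ : ϖ ≠ 0) (hαβ : α * β = ϖ ^ 2) {N : ℕ}
    (hN : N ≠ 0)
    (hα : ∀ A, A ≠ 0 → latticeExp φ ϖ (α * φ A) ≠ 0)
    (hβ : ∀ A, A ≠ 0 → latticeExp φ ϖ (β * φ A) ≠ 0) {U V : K}
    (hU : HasSum (fun A : {A : F[X] // A ≠ 0} => expTerm φ ϖ N α A) U)
    (hV : HasSum (fun A : {A : F[X] // A ≠ 0} => expTerm φ ϖ N β A) V) :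
    U + ϖ / α * (β / ϖ) ^ N * V = latticeZeta φ α (N + 1) + latticeZeta φ ϖ (N + 1) -
      ∑ i ∈ Finset.range N, latticeZeta φ α (i + 1) * latticeZeta φ ϖ (N - i) := by
  have hα0 : α ≠ 0 := by rintro rfl; exact pow_ne_zero 2 hϖ (by simpa using hαβ.symm)
  have hβ0 : β ≠ 0 := by rintro rfl; exact pow_ne_zero 2 hϖ (by simpa using hαβ.symm)
  have hα' := fun A hA => (hφ.latticeExp_ne_zero_iff hϖ).1 (hα A hA)
  have hβ' := fun A hA => (hφ.latticeExp_ne_zero_iff hϖ).1 (hβ A hA)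
  obtain ⟨L, hL, hϖL, hαL, hφL⟩ := hφ.exists_isComplete ϖ α
  have hS : Summable fun p : {A : F[X] // A ≠ 0} × {A : F[X] // A ≠ 0} =>
      (α * φ p.1)⁻¹ ^ N * (α * φ p.1 - ϖ * φ p.2)⁻¹ := by
    have hpow := tendsto_zero_iff_norm_tendsto_zero.1 (hφ.tendsto_inv_pow hα0 hN)
    refine summable_of_mem_of_tendsto_zero hL (fun p => ?_) (tendsto_cofinite_prod_of_norm_le
      (G := fun A => max ‖expTerm φ ϖ N α A‖ (‖(α * φ A)⁻¹ ^ N‖ * ‖ϖ‖⁻¹)) ?_ ?_ ?_)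
    · have h1 := mul_mem hαL (hφL p.1)
      exact mul_mem (pow_mem (inv_mem h1) _) (inv_mem (sub_mem h1 (mul_mem hϖL (hφL _))))
    · simpa using (tendsto_zero_iff_norm_tendsto_zero.1 hU.summable.tendsto_cofinite_zero).max
        (hpow.mul_const ‖ϖ‖⁻¹)
    · intro A B
      rw [expTerm, norm_mul, norm_mul, ← mul_max_of_nonneg _ _ (norm_nonneg _)]
      exact mul_le_mul_of_nonneg_left (hφ.norm_inv_sub_le_max hϖ (hα' A A.2) B) (norm_nonneg _)
    · intro A
      simpa using ((hφ.tendsto_inv_sub hϖ (α * φ A)).comp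
        Subtype.val_injective.tendsto_cofinite).const_mul ((α * φ A)⁻¹ ^ N)
  obtain ⟨s, hs⟩ := hS
  -- Rows: leaving out `B = 0` removes `(αA)⁻¹` from `1/e(αA)`, which costs the power sum of order
  -- `N+1`.
  have h1 : U - latticeZeta φ α (N + 1) = s := by
    refine (hU.sub (hφ.hasSum_latticeZeta hα0 N.succ_ne_zero)).unique
      (hs.prod_fiberwise fun A => ?_)
    have h := (hφ.hasSum_inv_sub_ne_zero hϖ (hα' A A.2)).mul_left ((α * φ A)⁻¹ ^ N)
    rw [mul_sub, ← pow_succ] at h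
    exact h
  have : NonarchimedeanRing K := ⟨NonarchimedeanAddGroup.is_nonarchimedean⟩
  have hs' := hs.add (hasSum_sum fun i (hi : i ∈ Finset.range N) =>
    (hφ.hasSum_latticeZeta hα0 i.succ_ne_zero).mul_of_nonarchimedean
      (hφ.hasSum_latticeZeta hϖ (Nat.sub_ne_zero_of_lt (Finset.mem_range.1 hi))))
  -- Columns: the added products of power sums turn `(αA)⁻ᴺ` into `(ϖB)⁻ᴺ`, constant in `A`.
  have h2 : -(ϖ / α * (β / ϖ) ^ N) * V + latticeZeta φ ϖ (N + 1) =
      s + ∑ i ∈ Finset.range N, latticeZeta φ α (i + 1) * latticeZeta φ ϖ (N - i) := by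
    refine ((hV.mul_left _).add (hφ.hasSum_latticeZeta hϖ N.succ_ne_zero)).unique
      (((Equiv.prodComm _ _).hasSum_iff.2 hs').prod_fiberwise fun B => ?_)
    have h := (hφ.hasSum_inv_sub_ne_zero hϖ (hβ' B B.2)).mul_left ((ϖ * φ B)⁻¹ ^ N * -(ϖ / α))
    have hB := hφ.ne_zero B.2
    have hβα : β = ϖ ^ 2 / α := by rw [← hαβ, mul_div_cancel_left₀ _ hα0]
    have e : (ϖ * φ B)⁻¹ ^ N * -(ϖ / α) * ((latticeExp φ ϖ (β * φ B))⁻¹ - (β * φ B)⁻¹) =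
        -(ϖ / α * (β / ϖ) ^ N) * expTerm φ ϖ N β B + (ϖ * φ B)⁻¹ ^ (N + 1) := by
      have e1 : (ϖ * φ B)⁻¹ ^ N = (β / ϖ) ^ N * (β * φ B)⁻¹ ^ N := by
        rw [← mul_pow]
        congr 1
        field_simp
      have e2 : ϖ / α * (β * φ B)⁻¹ = (ϖ * φ B)⁻¹ := by
        rw [hβα]
        field_simp
      rw [expTerm, pow_succ, e1]
      linear_combination (β / ϖ) ^ N * (β * φ B)⁻¹ ^ N * e2
    rw [e] at h
    refine h.congr_fun fun A => ?_
    have hsub : α * φ A - ϖ * φ B ≠ 0 := sub_ne_zero.2 (hα' A A.2 B)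
    have e3 : α * φ A - ϖ * φ B = -(α / ϖ) * (β * φ B - ϖ * φ A) := by
      rw [hβα]
      field_simp
      ring
    refine (inv_pow_mul_inv_sub (hφ.mul_ne_zero hα0 A.2) (hφ.mul_ne_zero hϖ B.2) hsub N).trans ?_
    rw [mul_assoc, e3, mul_inv (-(α / ϖ)), inv_neg, inv_div]
  linear_combination h1 - h2

end IsDiscreteHom

end Reciprocity

/-! ### From power sums to the coefficients of `z / e(z)` -/

section Coefficients

variable {F K : Type*} [Field F] [Fintype F] [NormedField K] {φ : F[X] →+* K} {ϖ : K}

theorem expCoeff_eq_zero (ϖ : K) {m : ℕ} (hm : ¬ q F - 1 ∣ m) : expCoeff φ ϖ m = 0 := by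
  have : m ≠ 0 := by rintro rfl; exact hm (dvd_zero _)
  rw [expCoeff, if_neg this, latticeZeta_eq_zero ϖ hm, neg_zero]

-- The two isolated power sums are the end terms, paired with the constant coefficient 1. They carry
-- one minus sign, the inner products two, which accounts for the opposite signs on the left.
omit [Fintype F] in
theorem sum_latticeZeta_eq (hϖ : ϖ ≠ 0) (α : K) (N : ℕ) :
    latticeZeta φ α (N + 1) + latticeZeta φ ϖ (N + 1) -
      ∑ i ∈ Finset.range N, latticeZeta φ α (i + 1) * latticeZeta φ ϖ (N - i) =
    -∑ i ∈ Finset.range (N + 2),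
      (ϖ / α) ^ (N + 1 - i) * (expCoeff φ ϖ (N + 1 - i) * expCoeff φ ϖ i) := by
  rw [← Finset.sum_flip, Finset.sum_range_succ, Finset.sum_range_succ']
  have h : ∀ i ∈ Finset.range N, (ϖ / α) ^ (N + 1 - (N + 1 - (i + 1))) *
      (expCoeff φ ϖ (N + 1 - (N + 1 - (i + 1))) * expCoeff φ ϖ (N + 1 - (i + 1))) =
      latticeZeta φ α (i + 1) * latticeZeta φ ϖ (N - i) := fun i hi => by
    have hi := Finset.mem_range.1 hi
    rw [Nat.sub_sub_self (by omega), Nat.add_sub_add_right, latticeZeta_eq_mul hϖ α, expCoeff,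
      expCoeff, if_neg (by omega), if_neg (by omega)]
    ring
  rw [Finset.sum_congr rfl h]
  simp only [expCoeff, latticeZeta_eq_mul hϖ α]
  simp
  ring

/-- Only the indices divisible by `q - 1` contribute. -/
theorem sum_expCoeff_eq (r : K) (n : ℕ) :
    ∑ i ∈ Finset.range ((q F - 1) * n + 1),
      r ^ ((q F - 1) * n - i) * (expCoeff φ ϖ ((q F - 1) * n - i) * expCoeff φ ϖ i) =
    ∑ k ∈ Finset.range (n + 1), r ^ ((q F - 1) * (n - k)) *
      (expCoeff φ ϖ ((q F - 1) * (n - k)) * expCoeff φ ϖ ((q F - 1) * k)) := by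
  have hq : 0 < q F - 1 := Nat.sub_pos_of_lt Fintype.one_lt_card
  symm
  refine Finset.sum_of_injOn (fun k => (q F - 1) * k) (fun a _ b _ h => ?_) (fun k hk => ?_)
    (fun i hi h => ?_) (fun k _ => ?_)
  · exact Nat.eq_of_mul_eq_mul_left hq h
  · have := Finset.mem_range.1 hk
    simp only [Finset.coe_range, Set.mem_Iio]
    exact Nat.lt_succ_of_le (Nat.mul_le_mul_left _ (by omega))
  · rw [expCoeff_eq_zero (m := i), mul_zero, mul_zero]
    rintro ⟨k, rfl⟩
    refine h ⟨k, ?_, rfl⟩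
    have hi := Nat.le_of_lt_succ (Finset.mem_range.1 hi)
    simpa [Nat.lt_succ_iff] using Nat.le_of_mul_le_mul_left hi hq
  · simp only [Nat.mul_sub]

end Coefficients

/-! ### Reciprocity over monic polynomials -/

section Main

variable {F K : Type*} [Field F] [Fintype F] [NormedField K] [IsUltrametricDist K]
  {φ : F[X] →+* K} {ϖ α β : K}

/-- Summability over all nonzero polynomials comes from the terms tending to zero; the monic formula
then identifies the value. -/
theorem IsDiscreteHom.hasSum_expTerm_of_monic (hφ : IsDiscreteHom φ) (hϖ : ϖ ≠ 0) {N : ℕ}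
    (hN : q F - 1 ∣ N + 1) {S : K}
    (hS : HasSum (fun A : Monic₁ F => expTerm φ ϖ N α A) S) :
    HasSum (fun A : {A : F[X] // A ≠ 0} => expTerm φ ϖ N α A) (-S) := by
  have h := (hφ.summable_expTerm hϖ (tendsto_cofinite_of_monic
    (fun c A => expTerm_C_mul hN c A) hS.summable.tendsto_cofinite_zero)).hasSum
  have h1 := (hasSum_monic φ (fun c A => expTerm_C_mul hN c A) h).unique hS
  rwa [← h1, neg_neg]

omit [Fintype F] [IsUltrametricDist K] in
theorem latticeExp_ne_zero_of_monic
    (h : ∀ A : Monic₁ F, latticeExp φ ϖ (α * φ A) ≠ 0) (A : F[X]) (hA : A ≠ 0) :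
    latticeExp φ ϖ (α * φ A) ≠ 0 := by
  obtain ⟨⟨c, M⟩, hp⟩ := monicEquiv.surjective ⟨A, hA⟩
  have hp := congrArg Subtype.val hp
  simp only [monicEquiv, Equiv.coe_fn_mk] at hp
  have hc : φ (Polynomial.C (c : F)) ≠ 0 := fun h =>
    c.ne_zero ((map_eq_zero (φ.comp Polynomial.C)).1 h)
  rw [← hp, map_mul, mul_left_comm, latticeExp_C_mul]
  exact mul_ne_zero hc (h M)

/-- The reciprocity formula, for sums over the monic polynomials. -/
theorem IsDiscreteHom.monic_reciprocity (hφ : IsDiscreteHom φ) (hϖ : ϖ ≠ 0)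
    (hαβ : α * β = ϖ ^ 2) {h n N : ℕ} (hN0 : N ≠ 0) (hqh : q F - 1 = 2 * h)
    (hN : N + 1 = (q F - 1) * n)
    (hα : ∀ A : Monic₁ F, latticeExp φ ϖ (α * φ A) ≠ 0)
    (hβ : ∀ A : Monic₁ F, latticeExp φ ϖ (β * φ A) ≠ 0) {S T : K}
    (hS : HasSum (fun A : Monic₁ F => (φ A)⁻¹ ^ N * (latticeExp φ ϖ (α * φ A))⁻¹) S)
    (hT : HasSum (fun A : Monic₁ F => (φ A)⁻¹ ^ N * (latticeExp φ ϖ (β * φ A))⁻¹) T) :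
    α ^ (1 - (h * n : ℤ)) * S + β ^ (1 - (h * n : ℤ)) * T =
      ∑ k ∈ Finset.range (n + 1), expCoeff φ ϖ ((q F - 1) * (n - k)) *
        expCoeff φ ϖ ((q F - 1) * k) * α ^ (h * k) * β ^ (h * (n - k)) := by
  have hα0 : α ≠ 0 := by rintro rfl; exact pow_ne_zero 2 hϖ (by simpa using hαβ.symm)
  have hβ0 : β ≠ 0 := by rintro rfl; exact pow_ne_zero 2 hϖ (by simpa using hαβ.symm)
  have hdvd : q F - 1 ∣ N + 1 := ⟨n, hN⟩
  have hmonic : ∀ γ S, HasSum (fun A : Monic₁ F => (φ A)⁻¹ ^ N * (latticeExp φ ϖ (γ * φ A))⁻¹) S →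
      HasSum (fun A : {A : F[X] // A ≠ 0} => expTerm φ ϖ N γ A) (-(γ⁻¹ ^ N * S)) := fun γ S hS => by
    refine hφ.hasSum_expTerm_of_monic hϖ hdvd ((hS.mul_left (γ⁻¹ ^ N)).congr_fun fun A => ?_)
    rw [expTerm, mul_inv, mul_pow, mul_assoc]
  have key := hφ.expTerm_reciprocity hϖ hαβ hN0 (latticeExp_ne_zero_of_monic hα)
    (latticeExp_ne_zero_of_monic hβ) (hmonic α S hS) (hmonic β T hT)
  rw [sum_latticeZeta_eq hϖ, show N + 2 = N + 1 + 1 from rfl, hN, sum_expCoeff_eq] at key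
  have hNz : (N : ℤ) = 2 * (h * n) - 1 := by
    have : (N : ℤ) + 1 = (2 * h : ℕ) * n := by rw [← hqh]; exact_mod_cast hN
    push_cast at this
    linarith
  have hϖz : ϖ ^ (2 : ℤ) = α * β := by rw [hαβ, zpow_ofNat]
  -- Multiplying `key` by `α ^ (h * n)` makes it symmetric: `N = 2hn - 1`, and `(ϖ/α)² = β/α` turns
  -- even powers of `ϖ/α` into powers of `α` and `β`.
  have e1 : α ^ (1 - (h * n : ℤ)) = α ^ (h * n) * α⁻¹ ^ N := by
    rw [inv_pow, ← zpow_natCast, ← zpow_natCast, ← zpow_neg, ← zpow_add₀ hα0]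
    congr 1
    push_cast
    linarith
  have e2 : β ^ (1 - (h * n : ℤ)) = α ^ (h * n) * (ϖ / α * (β / ϖ) ^ N * β⁻¹ ^ N) := by
    have h1 : (β / ϖ) ^ N * β⁻¹ ^ N = ϖ ^ (-(N : ℤ)) := by
      rw [← mul_pow, zpow_neg, zpow_natCast, ← inv_pow]
      congr 1
      field_simp
    have h2 : ϖ * ϖ ^ (-(N : ℤ)) = (α * β) ^ (1 - (h * n : ℤ)) := by
      rw [← hϖz, ← zpow_mul, ← zpow_one_add₀ hϖ]
      congr 1
      linarith
    have h3 : α ^ (h * n) * α⁻¹ * α ^ (1 - (h * n : ℤ)) = 1 := by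
      rw [← zpow_natCast, ← zpow_neg_one, ← zpow_add₀ hα0, ← zpow_add₀ hα0]
      rw [show ((h * n : ℕ) : ℤ) + -1 + (1 - (h * n : ℤ)) = 0 by push_cast; ring, zpow_zero]
    calc _ = (α ^ (h * n) * α⁻¹ * α ^ (1 - (h * n : ℤ))) * β ^ (1 - (h * n : ℤ)) := by
          rw [h3, one_mul]
      _ = α ^ (h * n) * α⁻¹ * (α * β) ^ (1 - (h * n : ℤ)) := by rw [mul_zpow, mul_assoc]
      _ = _ := by rw [← h2, mul_assoc (ϖ / α), h1, div_eq_mul_inv]; ring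
  have e3 : ∀ k ∈ Finset.range (n + 1), expCoeff φ ϖ ((q F - 1) * (n - k)) *
        expCoeff φ ϖ ((q F - 1) * k) * α ^ (h * k) * β ^ (h * (n - k)) =
      α ^ (h * n) * ((ϖ / α) ^ ((q F - 1) * (n - k)) *
        (expCoeff φ ϖ ((q F - 1) * (n - k)) * expCoeff φ ϖ ((q F - 1) * k))) := fun k hk => by
    have hk : k ≤ n := Nat.le_of_lt_succ (Finset.mem_range.1 hk)
    have h1 : (ϖ / α) ^ 2 = β / α := by rw [div_pow, ← hαβ]; field_simp
    have h2 : α ^ (h * n) = α ^ (h * k) * α ^ (h * (n - k)) := by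
      rw [← pow_add, ← mul_add, Nat.add_sub_cancel' hk]
    have h3 : α ^ (h * (n - k)) * (ϖ / α) ^ ((q F - 1) * (n - k)) = β ^ (h * (n - k)) := by
      rw [hqh, mul_assoc 2, pow_mul (ϖ / α), h1, ← mul_pow, mul_div_cancel₀ _ hα0]
    rw [h2, ← h3]
    ring
  rw [Finset.sum_congr rfl e3, ← Finset.mul_sum, e1, e2]
  linear_combination -(α ^ (h * n)) * key

end Main

/-! ### The concrete field `k_∞^ac` and the Carlitz period -/

variable (F : Type*) [Field F]

theorem valued_polynomial {A : F[X]} (hA : A ≠ 0) :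
    Valued.v (algebraMap (RatFunc F) (KInf F) (algebraMap F[X] (RatFunc F) A)) =
      (WithZero.exp (A.natDegree : ℤ) : ℤᵐ⁰) := by
  classical
  rw [RatFunc.valuedCompletionAtInfty.def]
  let _ := RatFunc.inftyValued F
  refine (Valued.extensionValuation_apply_coe (K := RatFunc F) _).trans ?_
  exact RatFunc.inftyValuation.polynomial F hA

variable [Fintype F]

instance isUltrametricDistKInf : IsUltrametricDist (KInf F) :=
  inferInstanceAs (@IsUltrametricDist (KInf F) (Valued.toNormedField (KInf F) ℤᵐ⁰).toDist)

instance isUltrametricDistKInfAC : IsUltrametricDist (KInfAC F) :=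
  IsUltrametricDist.isUltrametricDist_of_isNonarchimedean_norm
    (isNonarchimedean_spectralNorm (K := KInf F) (L := KInfAC F))

theorem norm_algebraMap_KInfAC (x : KInf F) : ‖algebraMap (KInf F) (KInfAC F) x‖ = ‖x‖ :=
  spectralNorm_extends x

theorem norm_ofPoly {A : F[X]} (hA : A ≠ 0) :
    ‖ofPoly F A‖ = ‖ofPoly F Polynomial.X‖ ^ A.natDegree := by
  rw [← norm_pow, ← map_pow, ofPoly, RingHom.comp_apply, RingHom.comp_apply, RingHom.comp_apply,
    RingHom.comp_apply, norm_algebraMap_KInfAC, norm_algebraMap_KInfAC]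
  refine le_antisymm (Valued.toNormedField.norm_le_iff.2 ?_) (Valued.toNormedField.norm_le_iff.2 ?_)
  all_goals
    rw [valued_polynomial F hA, valued_polynomial F (pow_ne_zero _ Polynomial.X_ne_zero)]
    simp

theorem one_lt_norm_ofPoly_X : 1 < ‖ofPoly F Polynomial.X‖ := by
  rw [ofPoly, RingHom.comp_apply, RingHom.comp_apply, norm_algebraMap_KInfAC]
  refine Valued.toNormedField.one_lt_norm_iff.2 ?_
  rw [RatFunc.algebraMap_X, valued_X, ← WithZero.exp_zero, WithZero.exp_lt_exp]
  exact one_pos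

theorem isComplete_of_finiteDimensional (L : IntermediateField (KInf F) (KInfAC F))
    [FiniteDimensional (KInf F) L] : IsComplete (L.toSubfield : Set (KInfAC F)) := by
  let _ : NormedSpace (KInf F) (KInfAC F) := spectralNorm.normedSpace (KInf F) (KInfAC F)
  have : FiniteDimensional (KInf F) (Subalgebra.toSubmodule L.toSubalgebra) :=
    inferInstanceAs (FiniteDimensional (KInf F) L)
  exact Submodule.complete_of_finiteDimensional (Subalgebra.toSubmodule L.toSubalgebra)

theorem finite_natDegree_le (n : ℕ) : {A : F[X] | A.natDegree ≤ n}.Finite := by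
  have : Finite (Polynomial.degreeLT F (n + 1)) :=
    Finite.of_equiv _ (Polynomial.degreeLTEquiv F (n + 1)).symm.toEquiv
  refine (Set.toFinite (Polynomial.degreeLT F (n + 1) : Set F[X])).subset fun A hA => ?_
  rw [SetLike.mem_coe, Polynomial.mem_degreeLT]
  exact Polynomial.degree_le_natDegree.trans_lt (by exact_mod_cast Nat.lt_succ_of_le hA)

/-- Discreteness holds because `|A| = |T| ^ deg A` with `|T| > 1`, and only finitely many
polynomials have bounded degree. -/
theorem isDiscreteHom_ofPoly : IsDiscreteHom (ofPoly F) where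
  one_le_norm A hA := by
    rw [norm_ofPoly F hA]
    exact one_le_pow₀ (one_lt_norm_ofPoly_X F).le
  tendsto_cobounded := by
    rw [← tendsto_norm_atTop_iff_cobounded, tendsto_atTop]
    intro b
    obtain ⟨n, hn⟩ := pow_unbounded_of_one_lt b (one_lt_norm_ofPoly_X F)
    rw [eventually_cofinite]
    refine (finite_natDegree_le F n).subset fun A hA => ?_
    by_contra h
    have h : n < A.natDegree := not_le.1 h
    have hA0 : A ≠ 0 := by rintro rfl; simp at h
    refine hA ?_
    rw [norm_ofPoly F hA0]
    exact hn.le.trans (pow_le_pow_right₀ (one_lt_norm_ofPoly_X F).le h.le)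
  exists_isComplete x y := by
    have : FiniteDimensional (KInf F) (IntermediateField.adjoin (KInf F) {x, y}) :=
      IntermediateField.finiteDimensional_adjoin fun z _ =>
        (AlgebraicClosure.isAlgebraic (KInf F)).isAlgebraic z |>.isIntegral
    exact ⟨(IntermediateField.adjoin (KInf F) {x, y}).toSubfield,
      isComplete_of_finiteDimensional F _,
      IntermediateField.subset_adjoin _ _ (by simp), IntermediateField.subset_adjoin _ _ (by simp),
      fun A => IntermediateField.algebraMap_mem _ _⟩

variable {F}

theorem IsCarlitzPeriod.ne_zero {ϖ : KInfAC F} (hϖ : IsCarlitzPeriod ϖ) : ϖ ≠ 0 := by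
  have hT := one_lt_norm_ofPoly_X F
  have hT0 : ofPoly F Polynomial.X ≠ 0 := norm_pos_iff.1 (one_pos.trans hT)
  have hq : 1 < q F := Fintype.one_lt_card
  have hnorm : ∀ i : ℕ,
      ‖(1 - ofPoly F Polynomial.X ^ (1 - (q F : ℤ) ^ (i + 1)))⁻¹‖ = 1 := fun i => by
    have hexp : 1 - (q F : ℤ) ^ (i + 1) < 0 := by
      have : 1 < (q F : ℤ) ^ (i + 1) := one_lt_pow₀ (by exact_mod_cast hq) i.succ_ne_zero
      linarith
    have hlt : ‖ofPoly F Polynomial.X ^ (1 - (q F : ℤ) ^ (i + 1))‖ < 1 := by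
      rw [norm_zpow]
      exact zpow_lt_one_of_neg₀ hT hexp
    rw [norm_inv, sub_eq_add_neg,
      IsUltrametricDist.norm_add_eq_max_of_norm_ne_norm (by simpa using hlt.ne'), norm_neg,
      norm_one, max_eq_left hlt.le, inv_one]
  have hprod : ∏' i : ℕ, (1 - ofPoly F Polynomial.X ^ (1 - (q F : ℤ) ^ (i + 1)))⁻¹ ≠ 0 := by
    -- Convergence need not be settled: a convergent product has norm 1, all factors being units,
    -- and otherwise `tprod` takes the default value 1.
    by_cases hm : Multipliable fun i : ℕ =>
        (1 - ofPoly F Polynomial.X ^ (1 - (q F : ℤ) ^ (i + 1)))⁻¹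
    · have h1 := (continuous_norm.tendsto _).comp hm.hasProd
      have h2 := tendsto_nhds_unique h1 ((tendsto_const_nhds (x := (1 : ℝ))).congr fun s => by
        rw [Function.comp_apply, norm_prod]
        exact (Finset.prod_eq_one fun i _ => hnorm i).symm)
      exact norm_pos_iff.1 (h2 ▸ one_pos)
    · rw [tprod_eq_one_of_not_multipliable hm]
      exact one_ne_zero
  rintro rfl
  rw [IsCarlitzPeriod, zero_pow (by omega)] at hϖ
  exact mul_ne_zero (neg_ne_zero.2 hT0) (pow_ne_zero _ (mul_ne_zero hT0 hprod)) hϖ.symm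

theorem carlitzExp_eq_latticeExp (ϖ z : KInfAC F) :
    carlitzExp ϖ z = latticeExp (ofPoly F) ϖ z := rfl

theorem carlitzFactorial_ne_zero (m : ℕ) : carlitzFactorial F m ≠ 0 := by
  have hq : 1 < q F := Fintype.one_lt_card
  refine Finset.prod_ne_zero_iff.2 fun i _ => pow_ne_zero _ (Finset.prod_ne_zero_iff.2 fun j hj => ?_)
  rw [sub_ne_zero]
  intro h
  have h := congrArg Polynomial.natDegree h
  rw [Polynomial.natDegree_X_pow, Polynomial.natDegree_X_pow] at h
  exact (Finset.mem_range.1 hj).ne' (Nat.pow_right_injective hq h)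

theorem bcQuot_eq_expCoeff {ϖ : KInfAC F} (hϖ : ϖ ≠ 0) (m : ℕ) :
    bcQuot ϖ m = expCoeff (ofPoly F) ϖ m := by
  have hφ := isDiscreteHom_ofPoly F
  have h : IsExpansion ϖ (expCoeff (ofPoly F) ϖ) := by
    rw [IsExpansion, eventually_nhdsWithin_iff]
    filter_upwards [Metric.ball_mem_nhds (0 : KInfAC F) (norm_pos_iff.2 hϖ)] with z hz hz0
    exact hφ.hasSum_div_latticeExp hz0 (by simpa using hz)
  have h2 := coeff_unique (Classical.epsilon_spec (p := IsExpansion ϖ) ⟨_, h⟩) h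
  rw [bcQuot, bernoulliCarlitz, h2,
    mul_div_cancel_left₀ _ (hφ.ne_zero (carlitzFactorial_ne_zero m))]

theorem ramanujanTerm_eq (ϖ γ : KInfAC F) (j : ℕ) (A : Monic₁ F) :
    ramanujanTerm ϖ j γ A = (ofPoly F A)⁻¹ ^ ((q F - 1) * j + (q F - 2)) *
      (latticeExp (ofPoly F) ϖ (γ * ofPoly F A))⁻¹ := by
  have hq : 1 < q F := Fintype.one_lt_card
  rw [ramanujanTerm, carlitzExp_eq_latticeExp, div_eq_mul_inv, inv_pow, ← zpow_natCast, ← zpow_neg]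
  congr 2
  push_cast [Nat.cast_sub hq.le, Nat.cast_sub (show 2 ≤ q F from hq)]
  ring

/-- An element outside `ϖ k_∞` is badly approximable by the multiples of `ϖ`. -/
theorem exists_le_norm_mul_sub {ϖ γ : KInfAC F} (hϖ : ϖ ≠ 0)
    (hγ : ∀ x : KInf F, γ ≠ ϖ * algebraMap (KInf F) (KInfAC F) x) :
    ∃ δ > 0, ∀ A : F[X], A ≠ 0 → ∀ B, δ ≤ ‖γ * ofPoly F A - ϖ * ofPoly F B‖ := by
  have hφ := isDiscreteHom_ofPoly F
  let L : IntermediateField (KInf F) (KInfAC F) := ⊥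
  -- As `k_∞` is closed, `γ/ϖ` has positive distance to it, hence to all fractions `B/A`;
  -- multiplying by `ϖA` only helps, since `|A| ≥ 1`.
  have hL : IsClosed (L.toSubfield : Set (KInfAC F)) := (isComplete_of_finiteDimensional F L).isClosed
  have hne : (L.toSubfield : Set (KInfAC F)).Nonempty := ⟨0, zero_mem L⟩
  have hmem : γ / ϖ ∉ (L.toSubfield : Set (KInfAC F)) := fun h => by
    obtain ⟨x, hx⟩ := IntermediateField.mem_bot.1 (show γ / ϖ ∈ L from h)
    exact hγ x (by rw [hx, mul_div_cancel₀ _ hϖ])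
  have hδ := (hL.notMem_iff_infDist_pos hne).1 hmem
  refine ⟨‖ϖ‖ * Metric.infDist (γ / ϖ) L.toSubfield, mul_pos (norm_pos_iff.2 hϖ) hδ,
    fun A hA B => ?_⟩
  have hA0 := hφ.ne_zero hA
  have e : γ * ofPoly F A - ϖ * ofPoly F B =
      ϖ * ofPoly F A * (γ / ϖ - ofPoly F B / ofPoly F A) := by
    field_simp
  rw [e, norm_mul, ← dist_eq_norm]
  refine mul_le_mul (hφ.norm_le_norm_mul ϖ hA) (Metric.infDist_le_dist_of_mem ?_) hδ.le
    (norm_nonneg _)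
  exact div_mem (L.algebraMap_mem _) (L.algebraMap_mem _)

theorem ne_zero_and_summable_ramanujanTerm {ϖ γ : KInfAC F} (hϖ : ϖ ≠ 0)
    (hγ : ∀ x : KInf F, γ ≠ ϖ * algebraMap (KInf F) (KInfAC F) x) {j : ℕ} (hj : 0 < j) :
    (∀ A : Monic₁ F, carlitzExp ϖ (γ * ofPoly F A) ≠ 0) ∧ Summable (ramanujanTerm ϖ j γ) := by
  have hφ := isDiscreteHom_ofPoly F
  have hγ0 : γ ≠ 0 := by simpa using hγ 0
  obtain ⟨δ, hδ, h⟩ := exists_le_norm_mul_sub hϖ hγ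
  have hq : 1 < q F := Fintype.one_lt_card
  set N := (q F - 1) * j + (q F - 2) with hN
  have hN0 : N ≠ 0 := by
    have := Nat.mul_pos (Nat.sub_pos_of_lt hq) hj
    omega
  have hdvd : q F - 1 ∣ N + 1 := ⟨j + 1, by rw [mul_add, hN]; omega⟩
  refine ⟨fun A => (hφ.latticeExp_ne_zero_iff hϖ).2 fun B hB => ?_, ?_⟩
  · have := h A A.2.ne_zero B
    rw [hB, sub_self, norm_zero] at this
    exact this.not_gt hδ
  · have h1 := hφ.summable_expTerm hϖ (hφ.tendsto_expTerm_of_le_norm_sub hϖ hγ0 hN0 hδ h)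
    have h2 := hasSum_monic (ofPoly F) (fun c A => expTerm_C_mul hdvd c A) h1.hasSum
    refine (h2.summable.mul_left (γ ^ N)).congr fun A => ?_
    rw [ramanujanTerm_eq, expTerm, mul_inv γ, mul_pow, mul_assoc, ← mul_assoc (γ ^ N), ← mul_pow,
      mul_inv_cancel₀ hγ0, one_pow, one_mul]

end Carlitz

end

/-! ### The theorem -/

open Carlitz in
theorem theorem1p2 (F : Type*) [Field F] [Fintype F] (hq : Odd (q F))
    (ϖ : KInfAC F) (hϖ : IsCarlitzPeriod ϖ)
    (α β : KInfAC F) (hαβ : α * β = ϖ ^ 2) (j : ℕ) (hj : 0 < j) :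
    -- if `α ∉ ϖ k_∞`, then all terms are defined and both series converge
    ((∀ x : KInf F, α ≠ ϖ * algebraMap (KInf F) (KInfAC F) x) →
      (∀ A : Monic₁ F, carlitzExp ϖ (α * ofPoly F A) ≠ 0 ∧ carlitzExp ϖ (β * ofPoly F A) ≠ 0) ∧
      Summable (ramanujanTerm ϖ j α) ∧ Summable (ramanujanTerm ϖ j β)) ∧
    -- whenever all terms are defined and both series converge, the identity holds
    ((∀ A : Monic₁ F, carlitzExp ϖ (α * ofPoly F A) ≠ 0 ∧ carlitzExp ϖ (β * ofPoly F A) ≠ 0) →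
      Summable (ramanujanTerm ϖ j α) → Summable (ramanujanTerm ϖ j β) →
      α ^ (-(((q F : ℤ) - 1) / 2) * ((j : ℤ) - 1) - ((q F : ℤ) - 2)) * ∑' A, ramanujanTerm ϖ j α A +
        β ^ (-(((q F : ℤ) - 1) / 2) * ((j : ℤ) - 1) - ((q F : ℤ) - 2)) * ∑' A, ramanujanTerm ϖ j β A =
      ∑ k ∈ Finset.range (j + 2),
        bcQuot ϖ ((q F - 1) * (j + 1 - k)) * bcQuot ϖ ((q F - 1) * k) *
          α ^ ((q F - 1) / 2 * k) * β ^ ((q F - 1) / 2 * (j + 1 - k))) := by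
  have hϖ0 := hϖ.ne_zero
  have hα0 : α ≠ 0 := by rintro rfl; exact pow_ne_zero 2 hϖ0 (by simpa using hαβ.symm)
  constructor
  · intro hα
    have hβ : ∀ x : KInf F, β ≠ ϖ * algebraMap (KInf F) (KInfAC F) x := fun x hx => by
      have h1 : α * algebraMap (KInf F) (KInfAC F) x = ϖ := by
        refine mul_left_cancel₀ hϖ0 ?_
        rw [← pow_two, ← hαβ, hx]
        ring
      have hx0 : algebraMap (KInf F) (KInfAC F) x ≠ 0 := fun h => hϖ0 (by rw [← h1, h, mul_zero])
      refine hα x⁻¹ ?_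
      rw [map_inv₀, eq_mul_inv_iff_mul_eq₀ hx0, h1]
    obtain ⟨h1, h2⟩ := ne_zero_and_summable_ramanujanTerm hϖ0 hα hj
    obtain ⟨h3, h4⟩ := ne_zero_and_summable_ramanujanTerm hϖ0 hβ hj
    exact ⟨fun A => ⟨h1 A, h3 A⟩, h2, h4⟩
  · intro hne hα hβ
    obtain ⟨h, hh⟩ := hq
    have h1 : 1 < q F := Fintype.one_lt_card
    have hqh : q F - 1 = 2 * h := by omega
    have key := (isDiscreteHom_ofPoly F).monic_reciprocity hϖ0 hαβ (h := h) (n := j + 1)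
      (N := (q F - 1) * j + (q F - 2)) (by omega) hqh (by rw [mul_add]; omega)
      (fun A => (hne A).1) (fun A => (hne A).2)
      (hα.hasSum.congr_fun fun A => (ramanujanTerm_eq ϖ α j A).symm)
      (hβ.hasSum.congr_fun fun A => (ramanujanTerm_eq ϖ β j A).symm)
    -- With `q = 2h + 1` the integer division is exact, and `-h(j-1) - (2h-1) = 1 - h(j+1)`.
    have hexp : -(((q F : ℤ) - 1) / 2) * ((j : ℤ) - 1) - ((q F : ℤ) - 2) =
        1 - (h : ℤ) * ((j + 1 : ℕ) : ℤ) := by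
      rw [hh, show (((2 * h + 1 : ℕ) : ℤ) - 1) / 2 = h by omega]
      push_cast
      ring
    have hhalf : (q F - 1) / 2 = h := by omega
    rw [hexp, hhalf, key]
    simp only [bcQuot_eq_expCoeff hϖ0]
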